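/- **Setting.** Let $N\ge 3$, $2\le k\le N$, and write $x=(y,z)\in\mathbb R^k\times\mathbb R^{N-k}$. Let $V:(0,\infty)\to\mathbb R$ be measurable with $V(s)\ge 0$ for all $s>0$, $V(s)\to 0$ as $s\to\infty$, and $V(\theta s)\le V(s)$ for all $s>0$, $\theta\ge 1$. Put $$\|u\|_c^2=\int_{\mathbb R^N}\big(|\nabla u|^2+V(|y|)u^2\big)\,dx,\qquad \|u\|_H^2=\|u\|_c^2+\int_{\mathbb R^N}u^2\,dx .$$ Let $H$ be the Hilbert space of those $u$ in the closure of $C_0^\infty((\mathbb R^k\setminus\{0\})\times\mathbb R^{N-k})$ (real-valued functions) with respect to $\|\cdot\|_H$ that are cylindrically symmetric, $u=u(|y|,z)$. For $\rho>0$ let $B_\rho=\{u:\int_{\mathbb R^N}u^2\,dx=\rho^2\}$. For a (Fréchet) differentiable $T:H\to\mathbb R$ let $$I(u)=\tfrac12\|u\|_c^2+T(u),\qquad I_\rho=\inf_{H\cap B_\rho}I .$$ A minimizing sequence is a sequence $(u_n)\subset H\cap B_\rho$ with $I(u_n)\to I_\rho$. **Theorem.** Assume $I_\rho>-\infty$,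 and let $(u_n)\subset H\cap B_\rho$ be a minimizing sequence such that 1. $u_n\rightharpoonup\bar u\ne 0$ weakly in $H$; 2. $T(u_n-\bar u)+T(\bar u)=T(u_n)+o(1)$; 3. $T(\alpha_n(u_n-\bar u))-T(u_n-\bar u)=o(1)$ for every real sequence $\alpha_n\to1$; 4. $\langle T'(v_n),v_n\rangle=O(1)$ for every minimizing sequence $(v_n)\subset H\cap B_\rho$ with $\|v_n-u_n\|_H\to0$ (in particular for $v_n=u_n$); 5. $\langle T'(v_n)-T'(v_m),v_n-v_m\rangle=o(1)$ as $n,m\to\infty$, for every minimizing sequence $(v_n)\subset H\cap B_\rho$ with $\|v_n-u_n\|_H\to0$ (in particular for $v_n=u_n$); 6. $T(u_\theta)\le\theta^2T(u)$ for all $u\in H$ and all $\theta>1$, where $u_\theta(x)=u(x/\theta^{2/N})$. Then $\bar u\in B_\rho$ and, up to a subsequence, $\|u_n-\bar u\|_H\to0$. -/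

import Mathlib

open MeasureTheory Filter Topology

noncomputable section

namespace CylMin

/-- The Euclidean space `ℝ^N = ℝ^k × ℝ^m` (so `N = k + m`), with points `x = (y, z)`. -/
abbrev Pt (k m : ℕ) : Type := EuclideanSpace ℝ (Fin k ⊕ Fin m)

/-- The component `y ∈ ℝ^k` of `x = (y, z)`. -/
def yPart {k m : ℕ} (x : Pt k m) : EuclideanSpace ℝ (Fin k) :=
  WithLp.toLp 2 fun i => x (Sum.inl i)

/-- The component `z ∈ ℝ^m` of `x = (y, z)`. -/
def zPart {k m : ℕ} (x : Pt k m) : EuclideanSpace ℝ (Fin m) :=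
  WithLp.toLp 2 fun j => x (Sum.inr j)

/-- The Hilbert sum `L²(ℝ^N) ⊕ L²(ℝ^N; ℝ^N) ⊕ L²(ℝ^N)`, in which a function `u` of finite
energy is represented by the triple `(u, ∇u, √V u)`. -/
abbrev Triple (k m : ℕ) : Type :=
  WithLp 2 (Lp ℝ 2 (volume : Measure (Pt k m)) ×
    WithLp 2 (Lp (Pt k m) 2 (volume : Measure (Pt k m)) ×
      Lp ℝ 2 (volume : Measure (Pt k m))))

/-- `φ ∈ C₀^∞((ℝ^k ∖ {0}) × ℝ^m)`. -/
def IsTest {k m : ℕ} (φ : Pt k m → ℝ) : Prop :=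
  ContDiff ℝ (⊤ : ℕ∞) φ ∧ HasCompactSupport φ ∧ tsupport φ ⊆ {x | yPart x ≠ 0}

/-- `w` is the triple `(φ, ∇φ, √V(|y|) φ)`. -/
def Represents {k m : ℕ} (V : ℝ → ℝ) (w : Triple k m) (φ : Pt k m → ℝ) : Prop :=
  (w.fst : Pt k m → ℝ) =ᵐ[volume] φ ∧
  (w.snd.fst : Pt k m → Pt k m) =ᵐ[volume] (fun x => gradient φ x) ∧
  (w.snd.snd : Pt k m → ℝ) =ᵐ[volume] fun x => √(V ‖yPart x‖) * φ x

/-- The triples `(φ, ∇φ, √V(|y|) φ)` of the test functions `φ`. -/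
def testTriples (k m : ℕ) (V : ℝ → ℝ) : Submodule ℝ (Triple k m) where
  carrier := {w | ∃ φ : Pt k m → ℝ, IsTest φ ∧ Represents V w φ}
  zero_mem' := by
    refine ⟨fun _ => 0, ⟨contDiff_const, HasCompactSupport.zero, ?_⟩, ?_, ?_, ?_⟩
    · simp [tsupport]
    · exact Lp.coeFn_zero _ _ _
    · filter_upwards [Lp.coeFn_zero (Pt k m) 2 (volume : Measure (Pt k m))] with x hx
      simpa [gradient_fun_const] using hx
    · filter_upwards [Lp.coeFn_zero ℝ 2 (volume : Measure (Pt k m))] with x hx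
      simpa using hx
  add_mem' := by
    rintro a b ⟨φ, ⟨hφ, hφc, hφs⟩, ha1, ha2, ha3⟩ ⟨ψ, ⟨hψ, hψc, hψs⟩, hb1, hb2, hb3⟩
    refine ⟨fun x => φ x + ψ x, ⟨hφ.add hψ, hφc.add hψc, ?_⟩, ?_, ?_, ?_⟩
    · exact (tsupport_add φ ψ).trans (Set.union_subset hφs hψs)
    · filter_upwards [Lp.coeFn_add a.fst b.fst, ha1, hb1] with x h h1 h2
      simpa [h1, h2] using h
    · filter_upwards [Lp.coeFn_add a.snd.fst b.snd.fst, ha2, hb2] with x h h1 h2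
      have e : gradient (fun x => φ x + ψ x) x = gradient φ x + gradient ψ x := by
        simp only [gradient]
        rw [fderiv_fun_add (hφ.differentiable (by simp) x) (hψ.differentiable (by simp) x),
          map_add]
      rw [e, ← h1, ← h2]
      exact h
    · filter_upwards [Lp.coeFn_add a.snd.snd b.snd.snd, ha3, hb3] with x h h1 h2
      rw [mul_add, ← h1, ← h2]
      exact h
  smul_mem' := by
    rintro c a ⟨φ, ⟨hφ, hφc, hφs⟩, ha1, ha2, ha3⟩
    refine ⟨fun x => c * φ x, ⟨contDiff_const.mul hφ, hφc.mul_left, ?_⟩, ?_, ?_, ?_⟩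
    · exact (tsupport_mul_subset_right (f := fun _ => c) (g := φ)).trans hφs
    · filter_upwards [Lp.coeFn_smul c a.fst, ha1] with x h h1
      rw [← h1]
      exact h
    · filter_upwards [Lp.coeFn_smul c a.snd.fst, ha2] with x h h1
      have e : gradient (fun x => c * φ x) x = c • gradient φ x := by
        simp only [gradient]
        rw [fderiv_const_mul (hφ.differentiable (by simp) x)]
        simp
      rw [e, ← h1]
      exact h
    · filter_upwards [Lp.coeFn_smul c a.snd.snd, ha3] with x h h1
      rw [mul_left_comm, ← h1]
      exact h

/-- The triples whose first component is cylindrically symmetric, `u = u(|y|, z)`. -/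
def cylTriples (k m : ℕ) : Submodule ℝ (Triple k m) where
  carrier := {w | ∃ f : ℝ → EuclideanSpace ℝ (Fin m) → ℝ,
    (w.fst : Pt k m → ℝ) =ᵐ[volume] fun x => f ‖yPart x‖ (zPart x)}
  zero_mem' := ⟨fun _ _ => 0, Lp.coeFn_zero _ _ _⟩
  add_mem' := by
    rintro a b ⟨f, hf⟩ ⟨g, hg⟩
    refine ⟨fun s z => f s z + g s z, ?_⟩
    filter_upwards [Lp.coeFn_add a.fst b.fst, hf, hg] with x h h1 h2
    rw [← h1, ← h2]
    exact h
  smul_mem' := by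
    rintro c a ⟨f, hf⟩
    refine ⟨fun s z => c * f s z, ?_⟩
    filter_upwards [Lp.coeFn_smul c a.fst, hf] with x h h1
    rw [← h1]
    exact h

/-- The space `H`: the cylindrically symmetric members of the closure of
`C₀^∞((ℝ^k ∖ {0}) × ℝ^m)` for the norm `‖u‖_H² = ∫ (|∇u|² + V(|y|) u² + u²) dx`.
The norm of a triple `(u, ∇u, √V u)` is `‖u‖_H`, so the completion is taken inside the complete
space of triples. In a limit of triples of test functions the second component is the
weak gradient of the first and the third is `√V(|y|)` times the first, so that
an element of `H` is determined by its function `u`. The norm, the topology, the derivative of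
functionals and weak convergence on `H` are those of this (Hilbert) subspace. -/
abbrev H (k m : ℕ) (V : ℝ → ℝ) : Type :=
  ↥((testTriples k m V).topologicalClosure ⊓ cylTriples k m)

variable {k m : ℕ} {V : ℝ → ℝ}

/-- The function `u : ℝ^N → ℝ` underlying an element of `H`. -/
def fn (u : H k m V) : Pt k m → ℝ := (u : Triple k m).fst

/-- The weak gradient `∇u : ℝ^N → ℝ^N`. -/
def grad (u : H k m V) : Pt k m → Pt k m := (u : Triple k m).snd.fst

/-- `‖u‖_c² = ∫ (|∇u|² + V(|y|) u²) dx`. -/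
def cNormSq (u : H k m V) : ℝ :=
  ∫ x, (‖grad u x‖ ^ 2 + V ‖yPart x‖ * fn u x ^ 2)

/-- `H ∩ B_ρ = {u ∈ H : ∫ u² dx = ρ²}`. -/
def B (k m : ℕ) (V : ℝ → ℝ) (ρ : ℝ) : Set (H k m V) :=
  {u | ∫ x, fn u x ^ 2 = ρ ^ 2}

/-- The functional `I(u) = ½ ‖u‖_c² + T(u)`. -/
def energy (T : H k m V → ℝ) (u : H k m V) : ℝ :=
  1 / 2 * cNormSq u + T u

/-- `(u_n)` is a minimizing sequence for `I_ρ = inf_{H ∩ B_ρ} I`, the infimum being finite. -/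
structure IsMinimizing (T : H k m V → ℝ) (ρ : ℝ) (u : ℕ → H k m V) : Prop where
  bddBelow : BddBelow (energy T '' B k m V ρ)
  mem : ∀ n, u n ∈ B k m V ρ
  tendsto : Tendsto (fun n => energy T (u n)) atTop (𝓝 (sInf (energy T '' B k m V ρ)))

/-- `v = u_θ`, where `u_θ(x) = u(x / θ^{2/N})` and `N = k + m`. -/
def IsDilation (θ : ℝ) (u v : H k m V) : Prop :=
  fn v =ᵐ[volume] fun x => fn u ((θ ^ ((2 : ℝ) / ((k + m : ℕ) : ℝ)))⁻¹ • x)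

end CylMin

end

/-!
Write `E(u) = ½ ‖u‖_c² + T(u)`, `μ = ‖ū‖_{L²}` and let `I` be the infimum of `E` on the sphere of
radius `ρ`. The argument has two halves, both carried out for a space `X` with two continuous
linear maps `P` and `Q` into Hilbert spaces, where `‖x‖² = ‖P x‖² + ‖Q x‖²`, `P` plays the role of
`u ↦ u ∈ L²` and `Q` that of `u ↦ (∇u, √V u)`.

*No loss of mass* (`norm_weakLimit_eq`). The dilation `u(x / θ^{2/N})`, `θ > 1`, multiplies the
`L²` norm by `θ`, the gradient term by `θ^{2 - 4/N} < θ²`, the potential term by at most `θ²`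
(because `V` is nonincreasing), and `T(u_θ) ≤ θ² T(u)`. As `∇w ≠ 0` for `w ≠ 0`, this gives
`E(w) > (‖w‖² / ρ²) I` whenever the `L²` norm `‖w‖` lies strictly between `0` and `ρ`. Weak
convergence splits the quadratic part of `E` and the hypothesis on `T` splits the rest, so
`E(u_n) = E(ū) + E(u_n - ū) + o(1)`. If `μ < ρ`, the inequality, applied to `ū` and, in the limit,
to `u_n - ū`, whose squared `L²` norm tends to `ρ² - μ²`, gives
`I > (μ² / ρ²) I + ((ρ² - μ²) / ρ²) I = I`; the strictness comes from `ū`.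
Therefore `μ = ρ`, and `u_n → ū` in `L²`.

*Strong convergence* (`tendsto_of_norm_weakLimit_eq`). Ekeland's principle
(`exists_ekeland_point`) on the sphere gives a minimizing sequence `v_n` with `‖v_n - u_n‖ → 0`
and `E'(v_n) - λ_n ⟨v_n, ·⟩_{L²} → 0` (`abs_sub_multiplier_le_of_ekeland`). The multipliers are
bounded since `⟨T'(v_n), v_n⟩` is. Subtracting the relations for `v_n` and `v_m` and testing with
`v_n - v_m` bounds `‖v_n - v_m‖_c²` by terms that vanish: those with multipliers because `v_n`
converges in `L²`, and the one with `T'` by hypothesis. So `v_n`, and with it `u_n`, converges in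
norm.

For the concrete space one needs completeness (`isClosed_cylTriples`), that the triple of an element
of `H` is determined by its function (`eq_zero_of_fst_eq_zero`), that a vanishing gradient forces
a vanishing function (`fst_eq_zero_of_gradient_eq_zero`, from the Gagliardo–Nirenberg–Sobolev
inequality, where `N ≥ 3` enters), and that `H` is stable under dilations (`exists_dilation`).
-/

noncomputable section

namespace CylMin

/-! ### Ekeland's variational principle -/

/-- **Ekeland's variational principle**, for continuous functions. -/
theorem exists_ekeland_point {X : Type*} [MetricSpace X] [CompleteSpace X] {f : X → ℝ}
    (hf : Continuous f) (hb : BddBelow (Set.range f)) {ε : ℝ} (hε : 0 < ε) (x₀ : X) :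
    ∃ v, f v + ε * dist x₀ v ≤ f x₀ ∧ ∀ w, f v ≤ f w + ε * dist v w := by
  -- The points reachable from `x` by a descent of slope at least `ε`; each step of the iteration
  -- below nearly minimizes `f` over this set.
  let S : X → Set X := fun x => {w | f w + ε * dist x w ≤ f x}
  have hself : ∀ x, x ∈ S x := fun x => by simp [S]
  have htrans : ∀ {x y z}, y ∈ S x → z ∈ S y → z ∈ S x := by
    intro x y z hy hz
    simp only [S, Set.mem_ofPred_eq] at *
    have := mul_le_mul_of_nonneg_left (dist_triangle x y z) hε.le
    linarith
  have hstep : ∀ (n : ℕ) (x : X), ∃ y ∈ S x, ∀ w ∈ S x, f y ≤ f w + 1 / ((n : ℝ) + 1) := by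
    intro n x
    have hbS : BddBelow (f '' S x) := hb.mono (Set.image_subset_range _ _)
    obtain ⟨_, ⟨y, hy, rfl⟩, hlt⟩ := exists_lt_of_csInf_lt (Set.Nonempty.image f ⟨x, hself x⟩)
      (lt_add_of_pos_right (sInf (f '' S x)) (Nat.one_div_pos_of_nat (α := ℝ) (n := n)))
    refine ⟨y, hy, fun w hw => ?_⟩
    have := csInf_le hbS (Set.mem_image_of_mem f hw)
    linarith
  choose next hnext_mem hnext_le using hstep
  let x : ℕ → X := fun n => Nat.rec x₀ (fun n y => next n y) n
  have hchain : ∀ n j, x (n + j) ∈ S (x n) := by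
    intro n j
    induction j with
    | zero => exact hself _
    | succ j ih => exact htrans ih (hnext_mem _ _)
  have hanti : Antitone fun n => f (x n) := by
    refine antitone_nat_of_succ_le fun n => ?_
    have h : f (x (n + 1)) + ε * dist (x n) (x (n + 1)) ≤ f (x n) := hchain n 1
    have : 0 ≤ ε * dist (x n) (x (n + 1)) := by positivity
    linarith
  have hconv := tendsto_atTop_ciInf hanti
    (hb.mono (Set.range_comp_subset_range x f))
  have hcauchy : CauchySeq x := by
    rw [Metric.cauchySeq_iff']
    intro δ hδ
    obtain ⟨N, hN⟩ := Metric.cauchySeq_iff'.1 hconv.cauchySeq (ε * δ) (by positivity)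
    refine ⟨N, fun n hn => ?_⟩
    obtain ⟨j, rfl⟩ := Nat.exists_eq_add_of_le hn
    have h1 : f (x (N + j)) + ε * dist (x N) (x (N + j)) ≤ f (x N) := hchain N j
    have h2 := hN (N + j) hn
    rw [Real.dist_eq, abs_sub_comm] at h2
    have h3 := (le_abs_self _).trans_lt h2
    rw [dist_comm]
    exact lt_of_mul_lt_mul_left (by linarith) hε.le
  obtain ⟨v, hv⟩ := cauchySeq_tendsto_of_complete hcauchy
  have hvS : ∀ n, v ∈ S (x n) := by
    intro n
    have hclosed : IsClosed (S (x n)) :=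
      isClosed_le (hf.add (continuous_const.mul (continuous_const.dist continuous_id)))
        continuous_const
    refine hclosed.mem_of_tendsto hv (eventually_atTop.2 ⟨n, fun j hj => ?_⟩)
    obtain ⟨i, rfl⟩ := Nat.exists_eq_add_of_le hj
    exact hchain n i
  refine ⟨v, hvS 0, fun w => ?_⟩
  by_contra! hlt
  have hw : w ∈ S v := hlt.le
  have hle : f v ≤ f w := by
    have h1 : Tendsto (fun n => f (x (n + 1))) atTop (𝓝 (f v)) :=
      (tendsto_add_atTop_iff_nat 1).2 ((hf.tendsto v).comp hv)
    have h2 : Tendsto (fun n : ℕ => f w + 1 / ((n : ℝ) + 1)) atTop (𝓝 (f w + 0)) :=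
      tendsto_const_nhds.add tendsto_one_div_add_atTop_nhds_zero_nat
    rw [add_zero] at h2
    exact le_of_tendsto_of_tendsto' h1 h2 fun n =>
      hnext_le n (x n) w (htrans (hvS n) hw)
  have : 0 ≤ ε * dist v w := by positivity
  linarith

/-! ### Minimization on a sphere of a Hilbert space -/

section Abstract

variable {X Z : Type*} [NormedAddCommGroup X] [NormedSpace ℝ X]
  [NormedAddCommGroup Z] [InnerProductSpace ℝ Z]

/-- First-order condition for approximate minimality on the sphere `‖P x‖ = ρ`, in tangential
directions. -/
theorem neg_mul_norm_le_of_ekeland {E : X → ℝ} {E' : X →L[ℝ] ℝ} {v : X}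
    (hE : HasFDerivAt E E' v) (P : X →L[ℝ] Z) {ρ ε : ℝ} (hρ : 0 < ρ) (hv : ‖P v‖ = ρ)
    (hmin : ∀ w, ‖P w‖ = ρ → E v ≤ E w + ε * ‖w - v‖)
    {h : X} (hh : inner ℝ (P v) (P h) = 0) : -(ε * ‖h‖) ≤ E' h := by
  -- The radial projection onto the sphere of the line `v + t h`.
  let g : ℝ → ℝ := fun t => ρ ^ 2 + t ^ 2 * ‖P h‖ ^ 2
  let γ : ℝ → X := fun t => (ρ / √(g t)) • (v + t • h)
  have hgpos : ∀ t, 0 < g t := fun t => by positivity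
  have hnorm : ∀ t, ‖P (v + t • h)‖ ^ 2 = g t := by
    intro t
    rw [map_add, map_smul, norm_add_sq_real, hv, norm_smul, inner_smul_right, hh, mul_pow,
      Real.norm_eq_abs, sq_abs]
    ring
  have hγ_mem : ∀ t, ‖P (γ t)‖ = ρ := by
    intro t
    have : ‖P (v + t • h)‖ = √(g t) := by rw [← hnorm, Real.sqrt_sq (norm_nonneg _)]
    rw [map_smul, norm_smul, this, Real.norm_of_nonneg (by positivity),
      div_mul_cancel₀ _ (Real.sqrt_ne_zero'.2 (hgpos t))]
  have hg0 : √(g 0) = ρ := by simp [g, Real.sqrt_sq hρ.le]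
  have hγ0 : γ 0 = v := by
    simp only [γ, hg0, div_self hρ.ne', one_smul, zero_smul, add_zero]
  have hg : HasDerivAt g 0 0 := by
    have := ((hasDerivAt_pow 2 (0 : ℝ)).mul_const (‖P h‖ ^ 2)).const_add (ρ ^ 2)
    simpa [g] using this
  have hc : HasDerivAt (fun t => ρ / √(g t)) 0 0 := by
    have := (hasDerivAt_const (0 : ℝ) ρ).fun_div (hg.sqrt (hgpos 0).ne')
      (Real.sqrt_ne_zero'.2 (hgpos 0))
    simpa using this
  have hγ : HasDerivAt γ h 0 := by
    have h1 : HasDerivAt (fun t : ℝ => v + t • h) h 0 := by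
      simpa using ((hasDerivAt_id (0 : ℝ)).smul_const h).const_add v
    have := hc.fun_smul h1
    simpa only [hg0, div_self hρ.ne', one_smul, zero_smul, add_zero] using this
  have hEγ : HasDerivAt (fun t => E (γ t)) (E' h) 0 := by
    rw [← hγ0] at hE
    exact hE.comp_hasDerivAt 0 hγ
  have l1 := (hasDerivAt_iff_tendsto_slope_zero.1 hEγ).mono_left
    (nhdsWithin_mono 0 (s := Set.Ioi 0) (fun t (ht : (0 : ℝ) < t) => ht.ne'))
  have l2 := (hasDerivAt_iff_tendsto_slope_zero.1 hγ).mono_left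
    (nhdsWithin_mono 0 (s := Set.Ioi 0) (fun t (ht : (0 : ℝ) < t) => ht.ne'))
  have key := l1.add (l2.norm.const_mul ε)
  have : 0 ≤ E' h + ε * ‖h‖ := by
    refine ge_of_tendsto (x := 𝓝[>] (0 : ℝ)) key ?_
    filter_upwards [self_mem_nhdsWithin] with t ht
    have ht : (0 : ℝ) < t := ht
    have hm := hmin (γ t) (hγ_mem t)
    simp only [zero_add, hγ0, norm_smul, smul_eq_mul, norm_inv, Real.norm_of_nonneg ht.le]
    have : t⁻¹ * (E (γ t) - E v) + ε * (t⁻¹ * ‖γ t - v‖)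
        = t⁻¹ * (E (γ t) + ε * ‖γ t - v‖ - E v) := by ring
    rw [this]
    exact mul_nonneg (by positivity) (by linarith)
  linarith

/-- Approximate Lagrange multiplier rule on the sphere `‖P x‖ = ρ`; the multiplier is obtained by
testing with `v` itself. -/
theorem abs_sub_multiplier_le_of_ekeland {E : X → ℝ} {E' : X →L[ℝ] ℝ} {v : X}
    (hE : HasFDerivAt E E' v) (P : X →L[ℝ] Z) (hP : ∀ x, ‖P x‖ ≤ ‖x‖) {ρ ε : ℝ}
    (hρ : 0 < ρ) (hε : 0 ≤ ε) (hv : ‖P v‖ = ρ)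
    (hmin : ∀ w, ‖P w‖ = ρ → E v ≤ E w + ε * ‖w - v‖) (h : X) :
    |E' h - E' v / ρ ^ 2 * inner ℝ (P v) (P h)| ≤ ε * (1 + ‖v‖ / ρ) * ‖h‖ := by
  set a : ℝ := inner ℝ (P v) (P h) / ρ ^ 2 with ha
  -- The component of `h` tangent to the sphere at `v`.
  set q : X := h - a • v with hq
  have hort : inner ℝ (P v) (P q) = 0 := by
    rw [hq, map_sub, map_smul, inner_sub_right, inner_smul_right, real_inner_self_eq_norm_sq, hv,
      ha, div_mul_cancel₀ _ (by positivity), sub_self]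
  have h1 := neg_mul_norm_le_of_ekeland hE P hρ hv hmin hort
  have h2 := neg_mul_norm_le_of_ekeland hE P hρ hv hmin (h := -q) (by
    rw [map_neg, inner_neg_right, hort, neg_zero])
  rw [map_neg, norm_neg] at h2
  have hEq : E' h - E' v / ρ ^ 2 * inner ℝ (P v) (P h) = E' q := by
    rw [hq, map_sub, map_smul, smul_eq_mul, ha]
    ring
  have hqn : ‖q‖ ≤ (1 + ‖v‖ / ρ) * ‖h‖ := by
    have hcs : |inner ℝ (P v) (P h)| ≤ ρ * ‖h‖ :=
      (abs_real_inner_le_norm _ _).trans (by rw [hv]; gcongr; exact hP h)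
    calc ‖q‖ ≤ ‖h‖ + ‖a • v‖ := norm_sub_le _ _
      _ = ‖h‖ + |inner ℝ (P v) (P h)| / ρ ^ 2 * ‖v‖ := by
          rw [norm_smul, ha, Real.norm_eq_abs, abs_div, abs_of_nonneg (sq_nonneg ρ)]
      _ ≤ ‖h‖ + ρ * ‖h‖ / ρ ^ 2 * ‖v‖ := by gcongr
      _ = (1 + ‖v‖ / ρ) * ‖h‖ := by field_simp
  rw [hEq]
  calc |E' q| ≤ ε * ‖q‖ := abs_le.2 ⟨h1, by linarith⟩
    _ ≤ ε * ((1 + ‖v‖ / ρ) * ‖h‖) := by gcongr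
    _ = _ := by ring

/-- Brezis–Lieb splitting of the square of the norm of a linear image, for weak convergence in a
Hilbert space. -/
theorem tendsto_norm_sq_sub_of_weak (P : X →L[ℝ] Z) {u : ℕ → X} {a : X}
    (hweak : ∀ f : X →L[ℝ] ℝ, Tendsto (fun n => f (u n)) atTop (𝓝 (f a))) :
    Tendsto (fun n => ‖P (u n)‖ ^ 2 - ‖P (u n - a)‖ ^ 2) atTop (𝓝 (‖P a‖ ^ 2)) := by
  have h := ((hweak ((innerSL ℝ (P a)).comp P)).const_mul 2).sub_const (‖P a‖ ^ 2)
  simp only [ContinuousLinearMap.comp_apply, innerSL_apply_apply, real_inner_self_eq_norm_sq] at h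
  convert h using 2 with n
  · rw [map_sub, norm_sub_sq_real, real_inner_comm]
    ring
  · ring

variable {Y : Type*} [NormedAddCommGroup Y] [InnerProductSpace ℝ Y]

/-- No mass is lost in the weak limit: if dilation by `θ > 1` multiplies the mass norm by `θ` and
the energy by strictly less than `θ²`, then splitting the mass would cost strictly more energy than
the infimum. -/
theorem norm_weakLimit_eq (P : X →L[ℝ] Z) (Q : X →L[ℝ] Y) (hPinj : ∀ x, P x = 0 → x = 0)
    (T : X → ℝ) {ρ I : ℝ} (hρ : 0 < ρ)
    (hI : ∀ x, ‖P x‖ = ρ → I ≤ 1 / 2 * ‖Q x‖ ^ 2 + T x)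
    (hdil : ∀ w, w ≠ 0 → ∀ θ : ℝ, 1 < θ → ∃ w', ‖P w'‖ = θ * ‖P w‖ ∧
      1 / 2 * ‖Q w'‖ ^ 2 + T w' < θ ^ 2 * (1 / 2 * ‖Q w‖ ^ 2 + T w))
    {u : ℕ → X} {a : X} (ha : a ≠ 0) (hu : ∀ n, ‖P (u n)‖ = ρ)
    (huI : Tendsto (fun n => 1 / 2 * ‖Q (u n)‖ ^ 2 + T (u n)) atTop (𝓝 I))
    (hweak : ∀ f : X →L[ℝ] ℝ, Tendsto (fun n => f (u n)) atTop (𝓝 (f a)))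
    (hsplit : Tendsto (fun n => T (u n - a) + T a - T (u n)) atTop (𝓝 0)) :
    ‖P a‖ = ρ := by
  have hmass := tendsto_norm_sq_sub_of_weak P hweak
  have hμpos : 0 < ‖P a‖ := norm_pos_iff.2 fun h => ha (hPinj a h)
  simp only [hu] at hmass
  have hPw : Tendsto (fun n => ‖P (u n - a)‖ ^ 2) atTop (𝓝 (ρ ^ 2 - ‖P a‖ ^ 2)) :=
    (hmass.const_sub (ρ ^ 2)).congr fun n => by ring
  have hle : ‖P a‖ ≤ ρ := by
    have := ge_of_tendsto' hPw fun n => sq_nonneg _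
    exact (sq_le_sq₀ hμpos.le hρ.le).1 (by linarith)
  by_contra hne
  have hlt : ‖P a‖ < ρ := lt_of_le_of_ne hle hne
  have hlower : ∀ w, 0 < ‖P w‖ → ‖P w‖ < ρ →
      ‖P w‖ ^ 2 / ρ ^ 2 * I < 1 / 2 * ‖Q w‖ ^ 2 + T w := by
    intro w hw0 hwρ
    have hw : w ≠ 0 := by rintro rfl; simp at hw0
    obtain ⟨w', h1, h2⟩ := hdil w hw (ρ / ‖P w‖) ((one_lt_div hw0).2 hwρ)
    rw [div_mul_cancel₀ _ hw0.ne'] at h1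
    have h3 := (hI w' h1).trans_lt h2
    rw [div_mul_eq_mul_div, div_lt_iff₀ (by positivity)]
    rw [div_pow, div_mul_eq_mul_div, lt_div_iff₀ (by positivity)] at h3
    linarith
  have hEw : Tendsto (fun n => 1 / 2 * ‖Q (u n - a)‖ ^ 2 + T (u n - a)) atTop
      (𝓝 (I - (1 / 2 * ‖Q a‖ ^ 2 + T a))) := by
    have h := ((huI.sub ((tendsto_norm_sq_sub_of_weak Q hweak).const_mul (1 / 2))).add
      hsplit).sub_const (T a)
    convert h using 2
    · ring
    · ring
  have hlim : (ρ ^ 2 - ‖P a‖ ^ 2) / ρ ^ 2 * I ≤ I - (1 / 2 * ‖Q a‖ ^ 2 + T a) := by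
    refine le_of_tendsto_of_tendsto ((hPw.div_const _).mul_const I) hEw ?_
    have hsq : ‖P a‖ ^ 2 < ρ ^ 2 := (sq_lt_sq₀ hμpos.le hρ.le).2 hlt
    have hμ2 : 0 < ‖P a‖ ^ 2 := by positivity
    filter_upwards [hPw.eventually_lt_const (u := ρ ^ 2) (by linarith),
      hPw.eventually_const_lt (u := 0) (by linarith)] with n h1 h2
    refine (hlower _ ?_ ?_).le
    · exact (norm_nonneg _).lt_of_ne fun h => by rw [← h] at h2; simp at h2
    · exact (sq_lt_sq₀ (norm_nonneg _) hρ.le).1 h1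
  have hstrict := hlower a hμpos hlt
  have : (ρ ^ 2 - ‖P a‖ ^ 2) / ρ ^ 2 * I = I - ‖P a‖ ^ 2 / ρ ^ 2 * I := by
    field_simp
  linarith

/-- A weakly convergent sequence is norm bounded. -/
theorem exists_norm_le_of_weak {u : ℕ → X} {a : X}
    (hweak : ∀ f : X →L[ℝ] ℝ, Tendsto (fun n => f (u n)) atTop (𝓝 (f a))) :
    ∃ M, ∀ n, ‖u n‖ ≤ M := by
  obtain ⟨M, hM⟩ := banach_steinhaus (g := fun n => NormedSpace.inclusionInDoubleDual ℝ X (u n))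
    (fun f => by
      obtain ⟨C, hC⟩ := (hweak f).norm.bddAbove_range
      exact ⟨C, fun n => by simpa using hC ⟨n, rfl⟩⟩)
  refine ⟨M, fun n => ?_⟩
  rw [← (NormedSpace.inclusionInDoubleDualLi ℝ (E := X)).norm_map (u n)]
  exact hM n

/-- Once the mass of the weak limit is full, a minimizing sequence converges in norm: Ekeland's
principle replaces it by an asymptotically critical one, which is Cauchy because testing the
difference of two Euler–Lagrange relations with the difference of the functions isolates
`‖Q (v n - v m)‖²`. -/
theorem tendsto_of_norm_weakLimit_eq [CompleteSpace X] (P : X →L[ℝ] Z) (Q : X →L[ℝ] Y)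
    (hPQ : ∀ x, ‖x‖ ^ 2 = ‖P x‖ ^ 2 + ‖Q x‖ ^ 2)
    {T : X → ℝ} (hT : Differentiable ℝ T) {ρ I : ℝ} (hρ : 0 < ρ)
    (hI : ∀ x, ‖P x‖ = ρ → I ≤ 1 / 2 * ‖Q x‖ ^ 2 + T x)
    {u : ℕ → X} {a : X} (ha : ‖P a‖ = ρ) (hu : ∀ n, ‖P (u n)‖ = ρ)
    (huI : Tendsto (fun n => 1 / 2 * ‖Q (u n)‖ ^ 2 + T (u n)) atTop (𝓝 I))
    (hweak : ∀ f : X →L[ℝ] ℝ, Tendsto (fun n => f (u n)) atTop (𝓝 (f a)))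
    (hbdd : ∀ v : ℕ → X, (∀ n, ‖P (v n)‖ = ρ) →
      Tendsto (fun n => 1 / 2 * ‖Q (v n)‖ ^ 2 + T (v n)) atTop (𝓝 I) →
      Tendsto (fun n => ‖v n - u n‖) atTop (𝓝 0) →
      ∃ C : ℝ, ∀ n, |fderiv ℝ T (v n) (v n)| ≤ C)
    (hcauchy : ∀ v : ℕ → X, (∀ n, ‖P (v n)‖ = ρ) →
      Tendsto (fun n => 1 / 2 * ‖Q (v n)‖ ^ 2 + T (v n)) atTop (𝓝 I) →
      Tendsto (fun n => ‖v n - u n‖) atTop (𝓝 0) →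
      Tendsto (fun p : ℕ × ℕ =>
        (fderiv ℝ T (v p.1) - fderiv ℝ T (v p.2)) (v p.1 - v p.2)) atTop (𝓝 0)) :
    Tendsto u atTop (𝓝 a) := by
  set E : X → ℝ := fun x => 1 / 2 * ‖Q x‖ ^ 2 + T x with hEdef
  have hPle : ∀ x, ‖P x‖ ≤ ‖x‖ := fun x =>
    (sq_le_sq₀ (norm_nonneg _) (norm_nonneg _)).1 (by nlinarith [hPQ x, sq_nonneg ‖Q x‖])
  have hQle : ∀ x, ‖Q x‖ ≤ ‖x‖ := fun x =>
    (sq_le_sq₀ (norm_nonneg _) (norm_nonneg _)).1 (by nlinarith [hPQ x, sq_nonneg ‖P x‖])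
  let E' : X → X →L[ℝ] ℝ := fun x => (innerSL ℝ (Q x)).comp Q + fderiv ℝ T x
  have hE : ∀ x, HasFDerivAt E (E' x) x := by
    intro x
    have h := (((hasStrictFDerivAt_norm_sq (Q x)).hasFDerivAt.comp x Q.hasFDerivAt).const_mul
      (1 / 2 : ℝ)).add (hT x).hasFDerivAt
    refine h.congr_fderiv ?_
    ext y
    simp [E']
  have hE'_apply : ∀ x y, E' x y = inner ℝ (Q x) (Q y) + fderiv ℝ T x y := fun x y => by simp [E']
  have hEcont : Continuous E := continuous_iff_continuousAt.2 fun x => (hE x).continuousAt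
  -- Ekeland's principle on the sphere, with `ε n` the square root of the excess energy.
  let ε : ℕ → ℝ := fun n => √(E (u n) - I + 1 / ((n : ℝ) + 1))
  have hexc : ∀ n, 0 < E (u n) - I + 1 / ((n : ℝ) + 1) := fun n => by
    have := hI (u n) (hu n)
    have h2 := Nat.one_div_pos_of_nat (α := ℝ) (n := n)
    simp only [hEdef]
    linarith
  have hεpos : ∀ n, 0 < ε n := fun n => Real.sqrt_pos.2 (hexc n)
  have hεlim : Tendsto ε atTop (𝓝 0) := by
    have h := ((huI.sub_const I).add tendsto_one_div_add_atTop_nhds_zero_nat).sqrt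
    simpa only [sub_self, add_zero, Real.sqrt_zero] using h
  let M := {x : X | ‖P x‖ = ρ}
  have hMclosed : IsClosed M := isClosed_eq P.continuous.norm continuous_const
  have : CompleteSpace M := hMclosed.completeSpace_coe
  have hek : ∀ n, ∃ v : X, ‖P v‖ = ρ ∧ E v + ε n * ‖u n - v‖ ≤ E (u n) ∧
      ∀ w, ‖P w‖ = ρ → E v ≤ E w + ε n * ‖w - v‖ := by
    intro n
    obtain ⟨v, h1, h2⟩ := exists_ekeland_point (X := M) (f := fun x => E x)
      (hEcont.comp continuous_subtype_val)
      ⟨I, by rintro _ ⟨x, rfl⟩; exact hI x x.2⟩ (hεpos n) ⟨u n, hu n⟩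
    refine ⟨v, v.2, ?_, fun w hw => ?_⟩
    · simpa [Subtype.dist_eq, dist_eq_norm] using h1
    · have := h2 ⟨w, hw⟩
      rwa [Subtype.dist_eq, dist_comm, dist_eq_norm] at this
  choose v hvM hvu hvmin using hek
  have hvu_le : ∀ n, ‖v n - u n‖ ≤ ε n := by
    intro n
    have h1 := hvu n
    have h2 := hI (v n) (hvM n)
    have h3 : ε n * ε n = E (u n) - I + 1 / ((n : ℝ) + 1) := Real.mul_self_sqrt (hexc n).le
    have h4 := Nat.one_div_pos_of_nat (α := ℝ) (n := n)
    rw [norm_sub_rev]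
    refine le_of_mul_le_mul_left ?_ (hεpos n)
    have h5 : I ≤ E (v n) := h2
    linarith
  have hvu_lim : Tendsto (fun n => ‖v n - u n‖) atTop (𝓝 0) :=
    squeeze_zero (fun n => norm_nonneg _) hvu_le hεlim
  have hvI : Tendsto (fun n => E (v n)) atTop (𝓝 I) := by
    refine tendsto_of_tendsto_of_tendsto_of_le_of_le tendsto_const_nhds huI
      (fun n => hI (v n) (hvM n)) fun n => ?_
    have : 0 ≤ ε n * ‖u n - v n‖ := mul_nonneg (hεpos n).le (norm_nonneg _)
    have := hvu n
    change E (v n) ≤ E (u n)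
    linarith
  obtain ⟨C, hC⟩ := hbdd v hvM hvI hvu_lim
  have hD := hcauchy v hvM hvI hvu_lim
  obtain ⟨K, hK⟩ : ∃ K, ∀ n, ‖v n‖ ≤ K := by
    obtain ⟨K₁, hK₁⟩ := exists_norm_le_of_weak hweak
    obtain ⟨K₂, hK₂⟩ := hvu_lim.bddAbove_range
    refine ⟨K₂ + K₁, fun n => ?_⟩
    have h1 : ‖v n - u n‖ ≤ K₂ := hK₂ ⟨n, rfl⟩
    have h2 := norm_add_le (v n - u n) (u n)
    rw [sub_add_cancel] at h2
    linarith [hK₁ n]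
  have hK0 : 0 ≤ K := (norm_nonneg _).trans (hK 0)
  have hC0 : 0 ≤ C := (abs_nonneg _).trans (hC 0)
  set L : ℝ := (K ^ 2 + C) / ρ ^ 2 with hL
  have hL0 : 0 ≤ L := by positivity
  have hmult : ∀ n, |E' (v n) (v n) / ρ ^ 2| ≤ L := by
    intro n
    rw [abs_div, abs_of_nonneg (sq_nonneg ρ), hL, hE'_apply, real_inner_self_eq_norm_sq]
    gcongr
    refine (abs_add_le _ _).trans (add_le_add ?_ (hC n))
    rw [abs_of_nonneg (sq_nonneg _)]
    gcongr
    exact (hQle _).trans (hK n)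
  -- Strong convergence of the masses.
  have hPu : Tendsto (fun n => P (u n)) atTop (𝓝 (P a)) := by
    have h := tendsto_norm_sq_sub_of_weak P hweak
    simp only [hu, ha] at h
    have h2 : Tendsto (fun n => ‖P (u n - a)‖ ^ 2) atTop (𝓝 0) := by
      rw [← sub_self (ρ ^ 2)]
      exact (h.const_sub (ρ ^ 2)).congr fun n => by ring
    have h3 := h2.sqrt
    simp only [Real.sqrt_sq (norm_nonneg _), Real.sqrt_zero, map_sub] at h3
    exact tendsto_iff_norm_sub_tendsto_zero.2 h3
  have hPv : Tendsto (fun n => P (v n)) atTop (𝓝 (P a)) := by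
    have h : Tendsto (fun n => P (v n - u n)) atTop (𝓝 (P 0)) :=
      (P.continuous.tendsto 0).comp (tendsto_zero_iff_norm_tendsto_zero.2 hvu_lim)
    simpa using h.add hPu
  have hPcau : Tendsto (fun p : ℕ × ℕ => ‖P (v p.1 - v p.2)‖) atTop (𝓝 0) := by
    have := cauchySeq_iff_tendsto_dist_atTop_0.1 hPv.cauchySeq
    simpa [dist_eq_norm] using this
  have hfst : Tendsto (fun p : ℕ × ℕ => p.1) atTop atTop := by
    rw [← prod_atTop_atTop_eq]; exact tendsto_fst
  have hsnd : Tendsto (fun p : ℕ × ℕ => p.2) atTop atTop := by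
    rw [← prod_atTop_atTop_eq]; exact tendsto_snd
  have hQest : ∀ n m, ‖Q (v n - v m)‖ ^ 2 ≤ (ε n + ε m) * ((1 + K / ρ) * (2 * K)) +
      2 * L * ρ * ‖P (v n - v m)‖ +
      |(fderiv ℝ T (v n) - fderiv ℝ T (v m)) (v n - v m)| := by
    intro n m
    set h := v n - v m with hh
    have hhK : ‖h‖ ≤ 2 * K := (norm_sub_le _ _).trans (by linarith [hK n, hK m])
    have hcrit : ∀ j, |E' (v j) h| ≤ ε j * ((1 + K / ρ) * (2 * K)) + L * ρ * ‖P h‖ := by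
      intro j
      have h1 := abs_sub_multiplier_le_of_ekeland (hE (v j)) P hPle hρ (hεpos j).le (hvM j)
        (hvmin j) h
      have h2 : |E' (v j) (v j) / ρ ^ 2 * inner ℝ (P (v j)) (P h)| ≤ L * (ρ * ‖P h‖) := by
        rw [abs_mul]
        gcongr
        · exact hmult j
        · rw [← hvM j]; exact abs_real_inner_le_norm _ _
      have h3 : ε j * (1 + ‖v j‖ / ρ) * ‖h‖ ≤ ε j * ((1 + K / ρ) * (2 * K)) := by
        rw [mul_assoc]
        have := (hεpos j).le
        gcongr
        exact hK j
      have h4 := abs_sub_abs_le_abs_sub (E' (v j) h)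
        (E' (v j) (v j) / ρ ^ 2 * inner ℝ (P (v j)) (P h))
      linarith
    have hid : ‖Q h‖ ^ 2 = E' (v n) h - E' (v m) h -
        (fderiv ℝ T (v n) - fderiv ℝ T (v m)) h := by
      rw [hE'_apply, hE'_apply, ← real_inner_self_eq_norm_sq]
      nth_rewrite 1 [hh]
      rw [map_sub, inner_sub_left, sub_apply]
      ring
    rw [hid]
    have a1 := le_abs_self (E' (v n) h)
    have a2 := neg_abs_le (E' (v m) h)
    have a3 := neg_abs_le ((fderiv ℝ T (v n) - fderiv ℝ T (v m)) h)
    have a4 := hcrit n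
    have a5 := hcrit m
    linarith
  have hQcau : Tendsto (fun p : ℕ × ℕ => ‖Q (v p.1 - v p.2)‖ ^ 2) atTop (𝓝 0) := by
    refine squeeze_zero (fun p => sq_nonneg _) (fun p => hQest p.1 p.2) ?_
    have h := ((((hεlim.comp hfst).add (hεlim.comp hsnd)).mul_const
      ((1 + K / ρ) * (2 * K))).add (hPcau.const_mul (2 * L * ρ))).add hD.abs
    simpa using h
  have hvcau : CauchySeq v := by
    rw [cauchySeq_iff_tendsto_dist_atTop_0]
    have h := ((hPcau.pow 2).add hQcau).sqrt
    simpa only [← hPQ, ← dist_eq_norm, Real.sqrt_sq dist_nonneg, ne_eq, OfNat.ofNat_ne_zero,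
      not_false_eq_true, zero_pow, add_zero, Real.sqrt_zero] using h
  obtain ⟨b, hb⟩ := cauchySeq_tendsto_of_complete hvcau
  have hub : Tendsto u atTop (𝓝 b) := by
    have := hb.sub (tendsto_zero_iff_norm_tendsto_zero.2 hvu_lim)
    simpa using this
  have hab : b = a := by
    have : ∀ f : X →L[ℝ] ℝ, f b = f a := fun f =>
      tendsto_nhds_unique ((f.continuous.tendsto b).comp hub) (hweak f)
    refine (SeparatingDual.eq_iff_forall_dual_eq (R := ℝ)).2 this
  exact hab ▸ hub

end Abstract

variable {k m : ℕ} {V : ℝ → ℝ}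

/-! ### Norms, completeness and the third component -/

theorem norm_sq_eq_integral {E : Type*} [NormedAddCommGroup E] [InnerProductSpace ℝ E]
    (f : Lp E 2 (volume : Measure (Pt k m))) : ‖f‖ ^ 2 = ∫ x, ‖f x‖ ^ 2 := by
  rw [← real_inner_self_eq_norm_sq, L2.inner_def]
  simp only [real_inner_self_eq_norm_sq]

theorem integrable_norm_sq {E : Type*} [NormedAddCommGroup E] [InnerProductSpace ℝ E]
    (f : Lp E 2 (volume : Measure (Pt k m))) : Integrable fun x => ‖f x‖ ^ 2 := by
  simpa only [real_inner_self_eq_norm_sq] using L2.integrable_inner (𝕜 := ℝ) f f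

theorem ae_yPart_ne_zero (hk : 0 < k) : ∀ᵐ x : Pt k m, yPart x ≠ 0 := by
  let S : Submodule ℝ (Pt k m) :=
    { carrier := {x | yPart x = 0}
      zero_mem' := rfl
      add_mem' := by
        intro a b ha hb
        have : yPart (a + b) = yPart a + yPart b := rfl
        simp only [Set.mem_ofPred_eq] at *
        rw [this, ha, hb, add_zero]
      smul_mem' := by
        intro c a ha
        have : yPart (c • a) = c • yPart a := rfl
        simp only [Set.mem_ofPred_eq] at *
        rw [this, ha, smul_zero] }
  have hS : S ≠ ⊤ := by
    intro h
    have hmem : EuclideanSpace.single (Sum.inl ⟨0, hk⟩) (1 : ℝ) ∈ S := h ▸ Submodule.mem_top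
    have h0 : yPart (EuclideanSpace.single (Sum.inl ⟨0, hk⟩) (1 : ℝ) : Pt k m) = 0 := hmem
    have := congrArg (fun y : EuclideanSpace ℝ (Fin k) => y ⟨0, hk⟩) h0
    simp [yPart] at this
  exact measure_eq_zero_iff_ae_notMem.1 (Measure.addHaar_submodule volume S hS)

/-- Convergent sequences of triples converge almost everywhere, in the first and third components,
along a subsequence. -/
theorem exists_subseq_tendsto_ae {w : ℕ → Triple k m} {a : Triple k m}
    (h : Tendsto w atTop (𝓝 a)) : ∃ ns : ℕ → ℕ, StrictMono ns ∧ ∀ᵐ x : Pt k m,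
      Tendsto (fun i => (w (ns i)).fst x) atTop (𝓝 (a.fst x)) ∧
      Tendsto (fun i => (w (ns i)).snd.snd x) atTop (𝓝 (a.snd.snd x)) := by
  have h1 : Tendsto (fun n => (w n).fst) atTop (𝓝 a.fst) :=
    ((WithLp.continuous_fst ..).tendsto a).comp h
  have h3 : Tendsto (fun n => (w n).snd.snd) atTop (𝓝 a.snd.snd) :=
    (((WithLp.continuous_snd ..).comp (WithLp.continuous_snd ..)).tendsto a).comp h
  obtain ⟨n₁, hn₁, hae₁⟩ := (tendstoInMeasure_of_tendsto_Lp h1).exists_seq_tendsto_ae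
  obtain ⟨n₂, hn₂, hae₂⟩ :=
    (tendstoInMeasure_of_tendsto_Lp (h3.comp hn₁.tendsto_atTop)).exists_seq_tendsto_ae
  refine ⟨n₁ ∘ n₂, hn₁.comp hn₂, ?_⟩
  filter_upwards [hae₁, hae₂] with x hx₁ hx₂
  exact ⟨hx₁.comp hn₂.tendsto_atTop, hx₂⟩

theorem isClosed_cylTriples : IsClosed (cylTriples k m : Set (Triple k m)) := by
  refine IsSeqClosed.isClosed fun w a hw ha => ?_
  obtain ⟨ns, -, hae⟩ := exists_subseq_tendsto_ae ha
  choose f hf using hw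
  -- The profiles converge at almost every `(‖y‖, z)`; where they do not, the limit is arbitrary.
  refine ⟨fun s z => limUnder atTop fun i => f (ns i) s z, ?_⟩
  filter_upwards [hae, ae_all_iff.2 hf] with x hx hfx
  have h := hx.1
  simp only [hfx] at h
  exact h.limUnder_eq.symm

instance instCompleteSpaceH : CompleteSpace (H k m V) :=
  (((testTriples k m V).isClosed_topologicalClosure).inter isClosed_cylTriples).completeSpace_coe

/-- On the closure of the test triples the third component is `√V` times the first. -/
theorem snd_snd_ae_eq {w : Triple k m} (hw : w ∈ (testTriples k m V).topologicalClosure) :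
    (w.snd.snd : Pt k m → ℝ) =ᵐ[volume] fun x => √(V ‖yPart x‖) * w.fst x := by
  obtain ⟨s, hs, hlim⟩ := mem_closure_iff_seq_limit.1 hw
  obtain ⟨ns, -, hae⟩ := exists_subseq_tendsto_ae hlim
  choose φ hφ hrep using hs
  filter_upwards [hae, ae_all_iff.2 fun n => (hrep n).1, ae_all_iff.2 fun n => (hrep n).2.2]
    with x hx h1 h3
  refine tendsto_nhds_unique hx.2 ?_
  have : ∀ n, (s n).snd.snd x = √(V ‖yPart x‖) * (s n).fst x := fun n => by rw [h1, h3]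
  simp only [this]
  exact hx.1.const_mul _

theorem cNormSq_eq (hk : 0 < k) (hV : ∀ s : ℝ, 0 < s → 0 ≤ V s) (u : H k m V) :
    cNormSq u = ‖(u : Triple k m).snd‖ ^ 2 := by
  rw [WithLp.prod_norm_sq_eq_of_L2, norm_sq_eq_integral, norm_sq_eq_integral, cNormSq,
    ← integral_add (integrable_norm_sq _) (integrable_norm_sq _)]
  refine integral_congr_ae ?_
  filter_upwards [snd_snd_ae_eq u.2.1, ae_yPart_ne_zero hk] with x h3 hy
  rw [h3, norm_mul, mul_pow, Real.norm_eq_abs, Real.norm_eq_abs, sq_abs, sq_abs,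
    Real.sq_sqrt (hV _ (norm_pos_iff.2 hy))]
  rfl

theorem mem_B_iff {ρ : ℝ} (hρ : 0 < ρ) (u : H k m V) :
    u ∈ B k m V ρ ↔ ‖(u : Triple k m).fst‖ = ρ := by
  have : ∫ x, fn u x ^ 2 = ‖(u : Triple k m).fst‖ ^ 2 := by
    rw [norm_sq_eq_integral]
    simp only [Real.norm_eq_abs, sq_abs]
    rfl
  change ∫ x, fn u x ^ 2 = ρ ^ 2 ↔ _
  rw [this, sq_eq_sq₀ (norm_nonneg _) hρ.le]

/-! ### Elements of `H` are determined by their function and by their gradient -/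

theorem inner_gradient {φ : Pt k m → ℝ} (x v : Pt k m) :
    inner ℝ (gradient φ x) v = fderiv ℝ φ x v := by
  simp [gradient]

/-- The second component is the weak gradient of the first: integration by parts passes to the
closure of the test triples. -/
theorem inner_weak_gradient {w : Triple k m}
    (hw : w ∈ (testTriples k m V).topologicalClosure) {ψ : Pt k m → ℝ}
    (hψ : ContDiff ℝ (⊤ : ℕ∞) ψ) (hψc : HasCompactSupport ψ) (v : Pt k m) :
    ∫ x, ψ x * inner ℝ (w.snd.fst x) v = -∫ x, w.fst x * fderiv ℝ ψ x v := by
  have hψ1 : MemLp (fun x => ψ x • v) 2 (volume : Measure (Pt k m)) :=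
    (hψ.continuous.smul continuous_const).memLp_of_hasCompactSupport hψc.smul_right
  have hDc : Continuous fun x => fderiv ℝ ψ x v :=
    (hψ.continuous_fderiv (by simp)).clm_apply continuous_const
  have hDs : HasCompactSupport fun x => fderiv ℝ ψ x v := hψc.fderiv_apply (𝕜 := ℝ) v
  have hψ2 : MemLp (fun x => fderiv ℝ ψ x v) 2 (volume : Measure (Pt k m)) :=
    hDc.memLp_of_hasCompactSupport hDs
  have e1 : ∀ w : Triple k m,
      ∫ x, ψ x * inner ℝ (w.snd.fst x) v = inner ℝ w.snd.fst hψ1.toLp := by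
    intro w
    rw [L2.inner_def]
    refine integral_congr_ae ?_
    filter_upwards [hψ1.coeFn_toLp] with x hx
    rw [hx, inner_smul_right]
  have e2 : ∀ w : Triple k m,
      ∫ x, w.fst x * fderiv ℝ ψ x v = inner ℝ w.fst hψ2.toLp := by
    intro w
    rw [L2.inner_def]
    refine integral_congr_ae ?_
    filter_upwards [hψ2.coeFn_toLp] with x hx
    rw [hx, real_inner_comm]
    simp
  have hclosed : IsClosed {w : Triple k m | inner ℝ w.snd.fst hψ1.toLp = -inner ℝ w.fst hψ2.toLp} :=
    isClosed_eq
      (((WithLp.continuous_fst ..).comp (WithLp.continuous_snd ..)).inner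
        continuous_const)
      ((WithLp.continuous_fst ..).inner continuous_const).neg
  rw [e1, e2]
  refine closure_minimal (fun w hw => ?_) hclosed hw
  obtain ⟨φ, hφ, h1, h2, -⟩ := hw
  change inner ℝ w.snd.fst hψ1.toLp = -inner ℝ w.fst hψ2.toLp
  rw [← e1, ← e2]
  have hφd : Continuous fun x => fderiv ℝ φ x v :=
    (hφ.1.continuous_fderiv (by simp)).clm_apply continuous_const
  have hparts := integral_mul_fderiv_eq_neg_fderiv_mul_of_integrable (f := φ) (g := ψ) (v := v)
    (μ := volume)
    ((hφd.mul hψ.continuous).integrable_of_hasCompactSupport hψc.mul_left)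
    ((hφ.1.continuous.mul hDc).integrable_of_hasCompactSupport hDs.mul_left)
    ((hφ.1.continuous.mul hψ.continuous).integrable_of_hasCompactSupport hψc.mul_left)
    (fun x _ => hφ.1.differentiable (by simp) x) (fun x _ => hψ.differentiable (by simp) x)
  have i1 : ∫ x, ψ x * inner ℝ (w.snd.fst x) v = ∫ x, fderiv ℝ φ x v * ψ x := by
    refine integral_congr_ae ?_
    filter_upwards [h2] with x hx
    rw [hx, inner_gradient, mul_comm]
  have i2 : ∫ x, w.fst x * fderiv ℝ ψ x v = ∫ x, φ x * fderiv ℝ ψ x v := by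
    refine integral_congr_ae ?_
    filter_upwards [h1] with x hx
    rw [hx]
  rw [i1, i2, hparts, neg_neg]

theorem eq_zero_of_fst_eq_zero {w : Triple k m}
    (hw : w ∈ (testTriples k m V).topologicalClosure) (h0 : w.fst = 0) : w = 0 := by
  have hfst : (w.fst : Pt k m → ℝ) =ᵐ[volume] 0 := by rw [h0]; exact Lp.coeFn_zero _ _ _
  have h3 : w.snd.snd = 0 := by
    refine (Lp.eq_zero_iff_ae_eq_zero).2 ?_
    filter_upwards [snd_snd_ae_eq hw, hfst] with x hx h
    rw [hx, h]
    simp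
  have hv : ∀ v : Pt k m, ∀ᵐ x : Pt k m, inner ℝ (w.snd.fst x) v = 0 := by
    intro v
    have hloc : LocallyIntegrable (fun x => inner ℝ (w.snd.fst x) v)
        (volume : Measure (Pt k m)) :=
      ((Lp.memLp w.snd.fst).inner_const (𝕜 := ℝ) v).locallyIntegrable (by norm_num)
    refine ae_eq_zero_of_integral_contDiff_smul_eq_zero hloc fun ψ hψ hψc => ?_
    simp only [smul_eq_mul]
    rw [inner_weak_gradient hw hψ hψc v, neg_eq_zero]
    refine integral_eq_zero_of_ae ?_
    filter_upwards [hfst] with x hx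
    rw [hx]
    simp
  have h2 : w.snd.fst = 0 := by
    refine (Lp.eq_zero_iff_ae_eq_zero).2 ?_
    filter_upwards [ae_all_iff.2 fun i => hv (EuclideanSpace.single i 1)] with x hx
    ext i
    simpa [EuclideanSpace.inner_single_right] using hx i
  have hn : ‖w‖ ^ 2 = 0 := by
    rw [WithLp.prod_norm_sq_eq_of_L2, WithLp.prod_norm_sq_eq_of_L2, h0, h2, h3]
    simp
  exact norm_eq_zero.1 (pow_eq_zero_iff two_ne_zero |>.1 hn)

/-- A function of `H` with zero gradient vanishes, by the Gagliardo–Nirenberg–Sobolev inequality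
for the approximating test functions. -/
theorem fst_eq_zero_of_gradient_eq_zero (hN : 3 ≤ k + m) {w : Triple k m}
    (hw : w ∈ (testTriples k m V).topologicalClosure) (h0 : w.snd.fst = 0) : w.fst = 0 := by
  obtain ⟨s, hs, hlim⟩ := mem_closure_iff_seq_limit.1 hw
  choose φ hφ hrep using hs
  have h1 : Tendsto (fun n => (s n).fst) atTop (𝓝 w.fst) :=
    ((WithLp.continuous_fst ..).tendsto w).comp hlim
  have h2 : Tendsto (fun n => (s n).snd.fst) atTop (𝓝 0) := by
    rw [← h0]
    exact (((WithLp.continuous_fst ..).comp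
      (WithLp.continuous_snd ..)).tendsto w).comp hlim
  have hdim : Module.finrank ℝ (Pt k m) = k + m := by simp
  -- The Sobolev exponent `2N / (N - 2)`.
  let q : NNReal := (2⁻¹ - ((k + m : ℕ) : NNReal)⁻¹)⁻¹
  have hinv : ((k + m : ℕ) : NNReal)⁻¹ < 2⁻¹ := by
    rw [inv_lt_inv₀ (by exact_mod_cast (by omega : 0 < k + m)) (by norm_num)]
    exact_mod_cast (by omega : 2 < k + m)
  have hq : (q : ℝ)⁻¹ = ((2 : NNReal) : ℝ)⁻¹ - ((k + m : ℕ) : ℝ)⁻¹ := by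
    simp only [q, NNReal.coe_inv, inv_inv]
    rw [NNReal.coe_sub hinv.le]
    simp
  have hq0 : (q : ENNReal) ≠ 0 := by
    rw [ENNReal.coe_ne_zero]
    exact inv_ne_zero (tsub_pos_of_lt hinv).ne'
  have hgns : ∀ n, eLpNorm ((s n).fst) q volume ≤
      eLpNormLESNormFDerivOfEqInnerConst (volume : Measure (Pt k m)) (2 : NNReal) *
        eLpNorm ((s n).snd.fst) 2 volume := by
    intro n
    have h := eLpNorm_le_eLpNorm_fderiv_of_eq_inner (volume : Measure (Pt k m)) (u := φ n)
      ((hφ n).1.of_le (by simp)) (hφ n).2.1 (p := 2) (p' := q) (by norm_num)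
      (by rw [hdim]; omega) (by rw [hdim]; exact hq)
    rw [eLpNorm_congr_ae (hrep n).1, eLpNorm_congr_ae (hrep n).2.1]
    refine h.trans_eq ?_
    congr 1
    refine eLpNorm_congr_norm_ae (ae_of_all _ fun x => ?_)
    simp [gradient]
  have hlimq : Tendsto (fun n => eLpNorm ((s n).fst) q volume) atTop (𝓝 0) := by
    have h3 : Tendsto (fun n => eLpNorm ((s n).snd.fst) 2 volume) atTop (𝓝 0) := by
      have := (continuous_enorm.tendsto (0 : Lp (Pt k m) 2 (volume : Measure (Pt k m)))).comp h2
      simpa [Function.comp_def, Lp.enorm_def] using this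
    have h4 := ENNReal.Tendsto.const_mul
      (a := (eLpNormLESNormFDerivOfEqInnerConst (volume : Measure (Pt k m)) (2 : NNReal) : ENNReal))
      h3 (Or.inr ENNReal.coe_ne_top)
    rw [mul_zero] at h4
    exact tendsto_of_tendsto_of_tendsto_of_le_of_le tendsto_const_nhds h4 (fun _ => zero_le) hgns
  have hmeas : TendstoInMeasure volume (fun n => ((s n).fst : Pt k m → ℝ)) atTop 0 :=
    tendstoInMeasure_of_tendsto_eLpNorm hq0 (fun n => Lp.aestronglyMeasurable _)
      aestronglyMeasurable_zero (by simpa using hlimq)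
  exact Lp.eq_zero_iff_ae_eq_zero.2
    (tendstoInMeasure_ae_unique (tendstoInMeasure_of_tendsto_Lp h1) hmeas)

/-! ### Dilations -/

theorem quasiMeasurePreserving_const_smul {c : ℝ} (hc : c ≠ 0) :
    Measure.QuasiMeasurePreserving (fun x : Pt k m => c • x) volume volume := by
  refine ⟨measurable_const_smul c, ?_⟩
  rw [Measure.map_addHaar_smul _ hc]
  exact Measure.smul_absolutelyContinuous

theorem memLp_comp_const_smul {E : Type*} [NormedAddCommGroup E] {c : ℝ} (hc : c ≠ 0)
    {f : Pt k m → E} (hf : MemLp f 2 volume) : MemLp (fun x => f (c • x)) 2 volume := by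
  have h : MemLp f 2 (Measure.map (fun x : Pt k m => c • x) volume) := by
    rw [Measure.map_addHaar_smul _ hc]
    exact hf.smul_measure ENNReal.ofReal_ne_top
  exact (memLp_map_measure_iff h.1 (measurable_const_smul c).aemeasurable).1 h

theorem norm_sq_of_ae_eq_comp_const_smul {E : Type*} [NormedAddCommGroup E]
    [InnerProductSpace ℝ E] {c : ℝ} (hc : 0 < c) {f g : Lp E 2 (volume : Measure (Pt k m))}
    (h : g =ᵐ[volume] fun x => f (c • x)) : ‖g‖ ^ 2 = (c ^ (k + m))⁻¹ * ‖f‖ ^ 2 := by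
  have h1 : ∫ x, ‖g x‖ ^ 2 = ∫ x, ‖f (c • x)‖ ^ 2 :=
    integral_congr_ae (h.mono fun x hx => by simp only [hx])
  rw [norm_sq_eq_integral, norm_sq_eq_integral, h1,
    Measure.integral_comp_smul volume (fun x => ‖f x‖ ^ 2) c, abs_of_nonneg (by positivity)]
  simp

/-- The operator `f ↦ r · f(c ·)` on `L²`, for a multiplier `|r| ≤ 1`. -/
theorem exists_weighted_dilation {E : Type*} [NormedAddCommGroup E] [InnerProductSpace ℝ E]
    {c : ℝ} (hc : 0 < c) {r : Pt k m → ℝ} (hr : Measurable r) (hr1 : ∀ᵐ x, |r x| ≤ 1) :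
    ∃ D : Lp E 2 (volume : Measure (Pt k m)) →L[ℝ] Lp E 2 (volume : Measure (Pt k m)),
      (∀ f, D f =ᵐ[volume] fun x => r x • f (c • x)) ∧
      ∀ f, ‖D f‖ ^ 2 ≤ (c ^ (k + m))⁻¹ * ‖f‖ ^ 2 := by
  have hdil : ∀ f : Lp E 2 (volume : Measure (Pt k m)),
      MemLp (fun x => f (c • x)) 2 (volume : Measure (Pt k m)) := fun f =>
    memLp_comp_const_smul hc.ne' (Lp.memLp f)
  have hmem : ∀ f : Lp E 2 (volume : Measure (Pt k m)),
      MemLp (fun x => r x • f (c • x)) 2 (volume : Measure (Pt k m)) := fun f => by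
    refine (hdil f).mono (hr.aestronglyMeasurable.smul (hdil f).1) ?_
    filter_upwards [hr1] with x hx
    rw [norm_smul]
    exact mul_le_of_le_one_left (norm_nonneg _) hx
  have hq := quasiMeasurePreserving_const_smul (k := k) (m := m) hc.ne'
  have hbound : ∀ f, ‖(hmem f).toLp‖ ^ 2 ≤ (c ^ (k + m))⁻¹ * ‖f‖ ^ 2 := by
    intro f
    rw [← norm_sq_of_ae_eq_comp_const_smul hc (hdil f).coeFn_toLp]
    gcongr
    refine Lp.norm_le_norm_of_ae_le ?_
    filter_upwards [(hmem f).coeFn_toLp, (hdil f).coeFn_toLp, hr1] with x h1 h2 hx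
    rw [h1, h2, norm_smul]
    exact mul_le_of_le_one_left (norm_nonneg _) hx
  let D₀ : Lp E 2 (volume : Measure (Pt k m)) →ₗ[ℝ] Lp E 2 (volume : Measure (Pt k m)) :=
    { toFun := fun f => (hmem f).toLp
      map_add' := fun f g => by
        ext1
        filter_upwards [(hmem (f + g)).coeFn_toLp, (hmem f).coeFn_toLp, (hmem g).coeFn_toLp,
          Lp.coeFn_add (hmem f).toLp (hmem g).toLp, hq.ae (Lp.coeFn_add f g)]
          with x h1 h2 h3 h4 h5
        rw [h1, h4, Pi.add_apply, h2, h3, h5, Pi.add_apply, smul_add]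
      map_smul' := fun a f => by
        ext1
        filter_upwards [(hmem (a • f)).coeFn_toLp, (hmem f).coeFn_toLp,
          Lp.coeFn_smul a (hmem f).toLp, hq.ae (Lp.coeFn_smul a f)] with x h1 h2 h3 h4
        rw [h1, RingHom.id_apply, h3, Pi.smul_apply, h2, h4, Pi.smul_apply, smul_comm] }
  refine ⟨D₀.mkContinuous √((c ^ (k + m))⁻¹) fun f => ?_, fun f => (hmem f).coeFn_toLp, hbound⟩
  refine (sq_le_sq₀ (norm_nonneg _) (by positivity)).1 ?_
  rw [mul_pow, Real.sq_sqrt (by positivity)]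
  exact hbound f

theorem IsTest.comp_const_smul {φ : Pt k m → ℝ} (hφ : IsTest φ) {c : ℝ} (hc : c ≠ 0) :
    IsTest fun x => φ (c • x) := by
  refine ⟨hφ.1.comp (contDiff_const_smul c), hφ.2.1.comp_homeomorph (Homeomorph.smulOfNeZero c hc),
    fun x hx => ?_⟩
  have h : yPart (c • x) ≠ 0 :=
    hφ.2.2 (tsupport_comp_subset_preimage φ (continuous_const_smul c) hx)
  have h2 : yPart (c • x) = c • yPart x := rfl
  rw [h2] at h
  exact right_ne_zero_of_smul h

theorem gradient_comp_const_smul (φ : Pt k m → ℝ) (c : ℝ) (x : Pt k m) :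
    gradient (fun x => φ (c • x)) x = c • gradient φ (c • x) := by
  simp only [gradient, fderiv_comp_smul, map_smul]

/-- The ratio `√V(|y|) / √V(c|y|)`, with `V` cut off at `0` to be measurable on all of `ℝ`. -/
def potentialRatio (V : ℝ → ℝ) (c : ℝ) (x : Pt k m) : ℝ :=
  √((Set.Ioi 0).indicator V ‖yPart x‖) / √((Set.Ioi 0).indicator V (c * ‖yPart x‖))

theorem measurable_potentialRatio (hV : Measurable fun s : Set.Ioi (0 : ℝ) => V s) (c : ℝ) :
    Measurable (potentialRatio V c : Pt k m → ℝ) := by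
  have hind : Measurable ((Set.Ioi (0 : ℝ)).indicator V) := by
    refine measurable_of_restrict_of_restrict_compl (measurableSet_Ioi (a := (0 : ℝ))) ?_ ?_
    · convert hV using 1
      ext s
      exact Set.indicator_of_mem s.2 V
    · convert measurable_const (a := (0 : ℝ)) using 1
      ext s
      exact Set.indicator_of_notMem s.2 V
  have hy : Measurable fun x : Pt k m => ‖yPart x‖ := by
    have : Continuous fun x : Pt k m => yPart x :=
      (PiLp.continuous_toLp 2 _).comp (continuous_pi fun i => by fun_prop)
    exact this.norm.measurable
  exact (hind.comp hy).sqrt.div (hind.comp (hy.const_mul c)).sqrt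

theorem potentialRatio_mul {x : Pt k m} (hx : yPart x ≠ 0)
    (hV3 : ∀ s θ : ℝ, 0 < s → 1 ≤ θ → V (θ * s) ≤ V s)
    {c : ℝ} (hc : 0 < c) (hc1 : c ≤ 1) :
    |potentialRatio V c x| ≤ 1 ∧
      potentialRatio V c x * √(V ‖yPart (c • x)‖) = √(V ‖yPart x‖) := by
  have hs : 0 < ‖yPart x‖ := norm_pos_iff.2 hx
  have hcs : 0 < c * ‖yPart x‖ := mul_pos hc hs
  have hle : √(V ‖yPart x‖) ≤ √(V (c * ‖yPart x‖)) := by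
    have := hV3 (c * ‖yPart x‖) c⁻¹ hcs ((one_le_inv₀ hc).2 hc1)
    rw [inv_mul_cancel_left₀ hc.ne'] at this
    exact Real.sqrt_le_sqrt this
  have hn : ‖yPart (c • x)‖ = c * ‖yPart x‖ := by
    have : yPart (c • x) = c • yPart x := rfl
    rw [this, norm_smul, Real.norm_of_nonneg hc.le]
  have hr : potentialRatio V c x = √(V ‖yPart x‖) / √(V (c * ‖yPart x‖)) := by
    rw [potentialRatio, Set.indicator_of_mem (Set.mem_Ioi.2 hs),
      Set.indicator_of_mem (Set.mem_Ioi.2 hcs)]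
  rw [hr, hn]
  refine ⟨?_, ?_⟩
  · rw [abs_of_nonneg (by positivity)]
    exact div_le_one_of_le₀ hle (Real.sqrt_nonneg _)
  · -- If `V(c|y|) = 0`, then `V(|y|) = 0` as well, so the junk quotient is harmless.
    refine div_mul_cancel_of_imp fun h => ?_
    exact le_antisymm (hle.trans h.le) (Real.sqrt_nonneg _)

/-- `H` is stable under the dilations `u ↦ u(c ·)` with `0 < c ≤ 1`; the potential energy is
controlled by the monotonicity of `V`. -/
theorem exists_dilation (hk : 0 < k)
    (hVmeas : Measurable fun s : Set.Ioi (0 : ℝ) => V s)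
    (hV3 : ∀ s θ : ℝ, 0 < s → 1 ≤ θ → V (θ * s) ≤ V s)
    {c : ℝ} (hc : 0 < c) (hc1 : c ≤ 1) (u : H k m V) :
    ∃ v : H k m V, (fn v =ᵐ[volume] fun x => fn u (c • x)) ∧
      ‖(v : Triple k m).fst‖ ^ 2 = (c ^ (k + m))⁻¹ * ‖(u : Triple k m).fst‖ ^ 2 ∧
      ‖(v : Triple k m).snd.fst‖ ^ 2 =
        c ^ 2 * ((c ^ (k + m))⁻¹ * ‖(u : Triple k m).snd.fst‖ ^ 2) ∧
      ‖(v : Triple k m).snd.snd‖ ^ 2 ≤ (c ^ (k + m))⁻¹ * ‖(u : Triple k m).snd.snd‖ ^ 2 := by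
  have hratio : ∀ᵐ x : Pt k m, |potentialRatio V c x| ≤ 1 ∧
      potentialRatio V c x * √(V ‖yPart (c • x)‖) = √(V ‖yPart x‖) :=
    (ae_yPart_ne_zero hk).mono fun x hx => potentialRatio_mul hx hV3 hc hc1
  have hq := quasiMeasurePreserving_const_smul (k := k) (m := m) hc.ne'
  obtain ⟨D₁, h₁, -⟩ := exists_weighted_dilation (E := ℝ) (k := k) (m := m) (r := fun _ => 1) hc
    measurable_const (by simp)
  obtain ⟨D₂, h₂, -⟩ := exists_weighted_dilation (E := Pt k m) (k := k) (m := m) (r := fun _ => 1)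
    hc measurable_const (by simp)
  obtain ⟨D₃, h₃, hn₃⟩ := exists_weighted_dilation (E := ℝ) (k := k) (m := m) hc
    (measurable_potentialRatio hVmeas c) (hratio.mono fun x hx => hx.1)
  simp only [one_smul] at h₁ h₂
  let D : Triple k m → Triple k m := fun w =>
    WithLp.toLp 2 (D₁ w.fst, WithLp.toLp 2 (c • D₂ w.snd.fst, D₃ w.snd.snd))
  have hD : Continuous D := by
    refine (WithLp.prod_continuous_toLp ..).comp (.prodMk ?_
      ((WithLp.prod_continuous_toLp ..).comp (.prodMk (.const_smul ?_ c) ?_)))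
    · exact D₁.continuous.comp (WithLp.continuous_fst ..)
    · exact D₂.continuous.comp ((WithLp.continuous_fst ..).comp (WithLp.continuous_snd ..))
    · exact D₃.continuous.comp ((WithLp.continuous_snd ..).comp (WithLp.continuous_snd ..))
  have hDtest : Set.MapsTo D (testTriples k m V) (testTriples k m V) := by
    rintro w ⟨φ, hφ, hr1, hr2, hr3⟩
    refine ⟨fun x => φ (c • x), hφ.comp_const_smul hc.ne', ?_, ?_, ?_⟩
    · exact (h₁ w.fst).trans (hq.ae_eq hr1)
    · filter_upwards [Lp.coeFn_smul c (D₂ w.snd.fst), h₂ w.snd.fst, hq.ae hr2] with x e1 e2 e3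
      rw [gradient_comp_const_smul, ← e3, ← e2]
      exact e1
    · filter_upwards [h₃ w.snd.snd, hq.ae hr3, hratio] with x e1 e2 e3
      refine e1.trans ?_
      rw [e2, smul_eq_mul, ← mul_assoc, e3.2]
  have hmem : D u ∈ (testTriples k m V).topologicalClosure ⊓ cylTriples k m := by
    refine ⟨map_mem_closure hD u.2.1 hDtest, ?_⟩
    obtain ⟨f, hf⟩ := u.2.2
    refine ⟨fun s z => f (c * s) (c • z), (h₁ _).trans ((hq.ae_eq hf).trans (.of_eq ?_))⟩
    funext x
    have e1 : yPart (c • x) = c • yPart x := rfl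
    have e2 : zPart (c • x) = c • zPart x := rfl
    simp only [Function.comp_apply, e1, e2, norm_smul, Real.norm_of_nonneg hc.le]
  refine ⟨⟨D u, hmem⟩, h₁ _, norm_sq_of_ae_eq_comp_const_smul hc (h₁ _), ?_, hn₃ _⟩
  change ‖c • D₂ (u : Triple k m).snd.fst‖ ^ 2 = _
  rw [norm_smul, mul_pow, norm_sq_of_ae_eq_comp_const_smul hc (h₂ _), Real.norm_of_nonneg hc.le]

/-- The map `u ↦ u` from `H` to `L²`. -/
def massMap : H k m V →L[ℝ] Lp ℝ 2 (volume : Measure (Pt k m)) :=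
  (WithLp.fstL 2 ℝ _ _).comp (Submodule.subtypeL _)

/-- The map `u ↦ (∇u, √V u)`, whose squared norm is `‖u‖_c²`. -/
def formMap : H k m V →L[ℝ] WithLp 2 (Lp (Pt k m) 2 (volume : Measure (Pt k m)) ×
    Lp ℝ 2 (volume : Measure (Pt k m))) :=
  (WithLp.sndL 2 ℝ _ _).comp (Submodule.subtypeL _)

theorem norm_sq_eq_massMap_add_formMap (w : H k m V) :
    ‖w‖ ^ 2 = ‖massMap w‖ ^ 2 + ‖formMap w‖ ^ 2 :=
  WithLp.prod_norm_sq_eq_of_L2 (w : Triple k m)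

theorem energy_eq (hk : 0 < k) (hV : ∀ s : ℝ, 0 < s → 0 ≤ V s) (T : H k m V → ℝ) (w : H k m V) :
    energy T w = 1 / 2 * ‖(w : Triple k m).snd‖ ^ 2 + T w := by
  rw [energy, cNormSq_eq hk hV]

/-- Dilation by `θ > 1` multiplies the mass norm by `θ` and the energy by strictly less than
`θ²`: the gradient term, which does not vanish, only scales by `θ ^ (2 - 4 / N)`. -/
theorem exists_dilation_lt (hk : 0 < k) (hN : 3 ≤ k + m)
    (hVmeas : Measurable fun s : Set.Ioi (0 : ℝ) => V s)
    (hV3 : ∀ s θ : ℝ, 0 < s → 1 ≤ θ → V (θ * s) ≤ V s)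
    {T : H k m V → ℝ} {θ : ℝ}
    (hscale : ∀ w wθ : H k m V, IsDilation θ w wθ → T wθ ≤ θ ^ 2 * T w)
    {w : H k m V} (hw : w ≠ 0) (hθ : 1 < θ) :
    ∃ w' : H k m V, ‖(w' : Triple k m).fst‖ = θ * ‖(w : Triple k m).fst‖ ∧
      1 / 2 * ‖(w' : Triple k m).snd‖ ^ 2 + T w' <
        θ ^ 2 * (1 / 2 * ‖(w : Triple k m).snd‖ ^ 2 + T w) := by
  have hθ0 : 0 < θ := by linarith
  have hNpos' : (0 : ℝ) < ((k + m : ℕ) : ℝ) := by exact_mod_cast (by omega : 0 < k + m)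
  have hNpos : (0 : ℝ) < 2 / ((k + m : ℕ) : ℝ) := by positivity
  obtain ⟨c, hcdef⟩ : ∃ c : ℝ, c = (θ ^ ((2 : ℝ) / ((k + m : ℕ) : ℝ)))⁻¹ := ⟨_, rfl⟩
  have hc : 0 < c := by rw [hcdef]; positivity
  have hc1 : c < 1 := by
    rw [hcdef]
    exact inv_lt_one_of_one_lt₀ (Real.one_lt_rpow hθ hNpos)
  have hcN : (c ^ (k + m))⁻¹ = θ ^ 2 := by
    rw [hcdef, inv_pow, inv_inv, ← Real.rpow_natCast, ← Real.rpow_mul hθ0.le,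
      div_mul_cancel₀ _ hNpos'.ne']
    norm_num
  obtain ⟨w', hfn, h1, h2, h3⟩ := exists_dilation hk hVmeas hV3 hc hc1.le w
  rw [hcN] at h1 h2 h3
  refine ⟨w', ?_, ?_⟩
  · rw [← mul_pow] at h1
    exact (sq_eq_sq₀ (norm_nonneg _) (by positivity)).1 h1
  · have hT' : T w' ≤ θ ^ 2 * T w := hscale w w' (by rw [IsDilation, ← hcdef]; exact hfn)
    have hgrad : 0 < ‖(w : Triple k m).snd.fst‖ ^ 2 := by
      have : (w : Triple k m).snd.fst ≠ 0 := fun h => hw (Subtype.ext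
        (eq_zero_of_fst_eq_zero w.2.1 (fst_eq_zero_of_gradient_eq_zero hN w.2.1 h)))
      positivity
    have hc2 : c ^ 2 < 1 := pow_lt_one₀ hc.le hc1 two_ne_zero
    have hlt : c ^ 2 * (θ ^ 2 * ‖(w : Triple k m).snd.fst‖ ^ 2) <
        θ ^ 2 * ‖(w : Triple k m).snd.fst‖ ^ 2 :=
      mul_lt_of_lt_one_left (by positivity) hc2
    rw [WithLp.prod_norm_sq_eq_of_L2, WithLp.prod_norm_sq_eq_of_L2]
    linarith

end CylMin

end

theorem theorem3p1 (k m : ℕ) (hk : 2 ≤ k) (hN : 3 ≤ k + m)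
    (V : ℝ → ℝ)
    (hVmeas : Measurable fun s : Set.Ioi (0 : ℝ) => V s)
    (hV1 : ∀ s : ℝ, 0 < s → 0 ≤ V s)
    (hV2 : Tendsto V atTop (𝓝 0))
    (hV3 : ∀ s θ : ℝ, 0 < s → 1 ≤ θ → V (θ * s) ≤ V s)
    (T : CylMin.H k m V → ℝ) (hT : Differentiable ℝ T)
    (ρ : ℝ) (hρ : 0 < ρ)
    (u : ℕ → CylMin.H k m V) (hu : CylMin.IsMinimizing T ρ u)
    (ubar : CylMin.H k m V) (hubar : ubar ≠ 0)
    (hweak : Tendsto (fun n => toWeakSpace ℝ (CylMin.H k m V) (u n)) atTop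
      (𝓝 (toWeakSpace ℝ (CylMin.H k m V) ubar)))
    (hsplit : Tendsto (fun n => T (u n - ubar) + T ubar - T (u n)) atTop (𝓝 0))
    (hresc : ∀ α : ℕ → ℝ, Tendsto α atTop (𝓝 1) →
      Tendsto (fun n => T (α n • (u n - ubar)) - T (u n - ubar)) atTop (𝓝 0))
    (hbdd : ∀ v : ℕ → CylMin.H k m V, CylMin.IsMinimizing T ρ v →
      Tendsto (fun n => ‖v n - u n‖) atTop (𝓝 0) →
      ∃ C : ℝ, ∀ n, |fderiv ℝ T (v n) (v n)| ≤ C)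
    (hcauchy : ∀ v : ℕ → CylMin.H k m V, CylMin.IsMinimizing T ρ v →
      Tendsto (fun n => ‖v n - u n‖) atTop (𝓝 0) →
      Tendsto (fun p : ℕ × ℕ =>
        (fderiv ℝ T (v p.1) - fderiv ℝ T (v p.2)) (v p.1 - v p.2)) atTop (𝓝 0))
    (hscale : ∀ θ : ℝ, 1 < θ → ∀ w wθ : CylMin.H k m V,
      CylMin.IsDilation θ w wθ → T wθ ≤ θ ^ 2 * T w) :
    ubar ∈ CylMin.B k m V ρ ∧
      ∃ φ : ℕ → ℕ, StrictMono φ ∧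
        Tendsto (fun n => ‖u (φ n) - ubar‖) atTop (𝓝 0) := by
  have hk0 : 0 < k := by omega
  let I : ℝ := sInf (CylMin.energy T '' CylMin.B k m V ρ)
  have henergy : ∀ w : CylMin.H k m V,
      CylMin.energy T w = 1 / 2 * ‖(w : CylMin.Triple k m).snd‖ ^ 2 + T w :=
    CylMin.energy_eq hk0 hV1 T
  have hB : ∀ w : CylMin.H k m V, w ∈ CylMin.B k m V ρ ↔
      ‖(w : CylMin.Triple k m).fst‖ = ρ := fun w => CylMin.mem_B_iff hρ w
  have hI : ∀ w : CylMin.H k m V, ‖(w : CylMin.Triple k m).fst‖ = ρ →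
      I ≤ 1 / 2 * ‖(w : CylMin.Triple k m).snd‖ ^ 2 + T w := fun w hw =>
    (csInf_le hu.bddBelow (Set.mem_image_of_mem _ ((hB w).2 hw))).trans_eq (henergy w)
  have hPinj : ∀ w : CylMin.H k m V, (w : CylMin.Triple k m).fst = 0 → w = 0 := fun w hw =>
    Subtype.ext (CylMin.eq_zero_of_fst_eq_zero w.2.1 hw)
  have huP : ∀ n, ‖(u n : CylMin.Triple k m).fst‖ = ρ := fun n => (hB _).1 (hu.mem n)
  have huI : Tendsto (fun n => 1 / 2 * ‖(u n : CylMin.Triple k m).snd‖ ^ 2 + T (u n)) atTop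
      (𝓝 I) := hu.tendsto.congr fun n => henergy _
  have hweak' : ∀ f : CylMin.H k m V →L[ℝ] ℝ, Tendsto (fun n => f (u n)) atTop (𝓝 (f ubar)) :=
    fun f => ((WeakBilin.eval_continuous _ f).tendsto _).comp hweak
  have hmin : ∀ v : ℕ → CylMin.H k m V, (∀ n, ‖(v n : CylMin.Triple k m).fst‖ = ρ) →
      Tendsto (fun n => 1 / 2 * ‖(v n : CylMin.Triple k m).snd‖ ^ 2 + T (v n)) atTop (𝓝 I) →
      CylMin.IsMinimizing T ρ v := fun v hv hvI =>
    ⟨hu.bddBelow, fun n => (hB _).2 (hv n), hvI.congr fun n => (henergy _).symm⟩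
  have hdil : ∀ w : CylMin.H k m V, w ≠ 0 → ∀ θ : ℝ, 1 < θ → ∃ w' : CylMin.H k m V,
      ‖(w' : CylMin.Triple k m).fst‖ = θ * ‖(w : CylMin.Triple k m).fst‖ ∧
      1 / 2 * ‖(w' : CylMin.Triple k m).snd‖ ^ 2 + T w' <
        θ ^ 2 * (1 / 2 * ‖(w : CylMin.Triple k m).snd‖ ^ 2 + T w) := fun w hw θ hθ =>
    CylMin.exists_dilation_lt hk0 hN hVmeas hV3 (hscale θ hθ) hw hθ
  have hnorm := CylMin.norm_weakLimit_eq CylMin.massMap CylMin.formMap hPinj T hρ hI hdil hubar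
    huP huI hweak' hsplit
  have hlim := CylMin.tendsto_of_norm_weakLimit_eq CylMin.massMap CylMin.formMap
    CylMin.norm_sq_eq_massMap_add_formMap hT hρ hI hnorm huP huI hweak'
    (fun v hv hvI => hbdd v (hmin v hv hvI)) (fun v hv hvI => hcauchy v (hmin v hv hvI))
  exact ⟨(hB _).2 hnorm, id, strictMono_id, tendsto_iff_norm_sub_tendsto_zero.1 hlim⟩
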